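/- Let $S_0$ be the triangle $K_3$, with its three vertices as corners, and for $n \ge 0$ let the stage-$(n+1)$ Sierpinski triangle $S_{n+1}$ be obtained from three copies of the stage-$n$ Sierpinski triangle $S_n$ by identifying, for each pair of copies, one corner of the first with one corner of the second (each copy having two of its corners identified in this way, with two different copies, and its third corner being a corner of $S_{n+1}$); the corners of $S_n$ are exactly its vertices of degree 2. For a graph $G$ with combinatorial Laplacian matrix $L_G$, let $r_G(u,v) = (\mathbf{e}_u-\mathbf{e}_v)^T L_G^{\dagger} (\mathbf{e}_u-\mathbf{e}_v)$ be the resistance distance between $u$ and $v$, where $\dagger$ denotes the Moore-Penrose inverse, and let $\mathcal{F}_G(u,v)$ be the number of spanning forests of $G$ that have exactly two components and have $u$ and $v$ in distinct components. Then for every $n \ge 0$ and any two distinct vertices $a, b$ of degree 2 in $S_n$, \[ r_{S_n}(a,b) = \frac{2}{3}\left(\frac{5}{3}\right)^n \] and \[ \mathcal{F}_{S_n}(a,b) = 2^{\frac{1}{2}(3^n+1)}\, 3^{\frac{1}{4}(3^{n+1}-2n-3)}\, 5^{\frac{1}{4}(3^n+2n-1)} . \] -/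

import Mathlib

/-- `X` is a Moore-Penrose inverse of the real matrix `A` (the four Penrose equations). -/
structure IsMoorePenroseInverse {m n : Type*} [Fintype m] [Fintype n]
    (A : Matrix m n ℝ) (X : Matrix n m ℝ) : Prop where
  mul_mul_self : A * X * A = A
  self_mul_mul : X * A * X = X
  transpose_mul : (A * X).transpose = A * X
  transpose_mul' : (X * A).transpose = X * A

theorem IsMoorePenroseInverse.unique {m n : Type*} [Fintype m] [Fintype n]
    {A : Matrix m n ℝ} {X Y : Matrix n m ℝ}
    (hX : IsMoorePenroseInverse A X) (hY : IsMoorePenroseInverse A Y) : X = Y := by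
  have h1 : A * X = A * Y := by
    have h : (A * Y) * (A * X) = A * X := by
      rw [← Matrix.mul_assoc, hY.mul_mul_self]
    have h' : (A * X) * (A * Y) = A * Y := by
      rw [← Matrix.mul_assoc, hX.mul_mul_self]
    rw [← h, ← hX.transpose_mul, ← hY.transpose_mul, ← Matrix.transpose_mul, h',
      hY.transpose_mul]
  have h2 : X * A = Y * A := by
    have h : (X * A) * (Y * A) = X * A := by
      rw [Matrix.mul_assoc, ← Matrix.mul_assoc A, hY.mul_mul_self]
    have h' : (Y * A) * (X * A) = Y * A := by
      rw [Matrix.mul_assoc, ← Matrix.mul_assoc A, hX.mul_mul_self]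
    rw [← h, ← hX.transpose_mul', ← hY.transpose_mul', ← Matrix.transpose_mul, h',
      hY.transpose_mul']
  rw [← hX.self_mul_mul, h2, Matrix.mul_assoc, h1, ← Matrix.mul_assoc, hY.self_mul_mul]

theorem IsMoorePenroseInverse.exists_of_isSymm {n : Type*} [Fintype n]
    {B : Matrix n n ℝ} (hB : B.transpose = B) :
    ∃ X : Matrix n n ℝ, IsMoorePenroseInverse B X ∧ X.transpose = X := by
  classical
  have hH : B.IsHermitian := by
    rw [Matrix.IsHermitian, Matrix.conjTranspose_eq_transpose_of_trivial, hB]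
  obtain ⟨U, d, hU, hBU⟩ : ∃ (U : Matrix n n ℝ) (d : n → ℝ), U.transpose * U = 1 ∧
      B = U * Matrix.diagonal d * U.transpose := by
    refine ⟨hH.eigenvectorUnitary, hH.eigenvalues, ?_, ?_⟩
    · have := Unitary.coe_star_mul_self hH.eigenvectorUnitary
      rwa [Matrix.star_eq_conjTranspose, Matrix.conjTranspose_eq_transpose_of_trivial] at this
    · have := hH.spectral_theorem
      rw [Unitary.conjStarAlgAut_apply, Matrix.star_eq_conjTranspose,
        Matrix.conjTranspose_eq_transpose_of_trivial] at this
      exact this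
  have key : ∀ e f : n → ℝ, (U * Matrix.diagonal e * U.transpose) *
      (U * Matrix.diagonal f * U.transpose) =
      U * Matrix.diagonal (fun i => e i * f i) * U.transpose := by
    intro e f
    calc _ = U * Matrix.diagonal e * (U.transpose * U) * Matrix.diagonal f * U.transpose := by
          simp only [Matrix.mul_assoc]
      _ = _ := by rw [hU, Matrix.mul_one, Matrix.mul_assoc U, Matrix.diagonal_mul_diagonal]
  have sym : ∀ e : n → ℝ, (U * Matrix.diagonal e * U.transpose).transpose =
      U * Matrix.diagonal e * U.transpose := by
    intro e
    simp [Matrix.transpose_mul, Matrix.mul_assoc]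
  refine ⟨U * Matrix.diagonal (fun i => (d i)⁻¹) * U.transpose, ⟨?_, ?_, ?_, ?_⟩, sym _⟩
  · rw [hBU, key, key]
    simp [mul_inv_mul_cancel]
  · rw [hBU, key, key]
    congr 3
    funext i
    simpa using mul_inv_mul_cancel (d i)⁻¹
  · rw [hBU, key, sym]
  · rw [hBU, key, sym]

theorem IsMoorePenroseInverse.exists {m n : Type*} [Fintype m] [Fintype n]
    (A : Matrix m n ℝ) : ∃ X : Matrix n m ℝ, IsMoorePenroseInverse A X := by
  classical
  obtain ⟨P, hP, hPs⟩ := IsMoorePenroseInverse.exists_of_isSymm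
    (B := A.transpose * A) (by simp [Matrix.transpose_mul])
  have h0 : A * (P * (A.transpose * A) - 1) = 0 := by
    rw [← Matrix.conjTranspose_mul_self_eq_zero, Matrix.conjTranspose_eq_transpose_of_trivial,
      Matrix.transpose_mul]
    calc _ = (P * (A.transpose * A) - 1).transpose *
          (A.transpose * A * P * (A.transpose * A) - A.transpose * A) := by
          simp only [Matrix.mul_assoc, Matrix.mul_sub, Matrix.mul_one]
      _ = 0 := by rw [hP.mul_mul_self]; simp
  have h1 : A * (P * (A.transpose * A)) = A := by
    rwa [Matrix.mul_sub, Matrix.mul_one, sub_eq_zero] at h0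
  refine ⟨P * A.transpose, ?_, ?_, ?_, ?_⟩
  · simpa only [Matrix.mul_assoc] using h1
  · have := congrArg (· * A.transpose) hP.self_mul_mul
    simpa only [Matrix.mul_assoc] using this
  · simp [Matrix.transpose_mul, hPs, Matrix.mul_assoc]
  · simpa only [Matrix.mul_assoc] using hP.transpose_mul'

/-- The Moore-Penrose inverse of a real matrix. -/
noncomputable def moorePenroseInverse {m n : Type*} [Fintype m] [Fintype n]
    (A : Matrix m n ℝ) : Matrix n m ℝ :=
  Classical.choose (IsMoorePenroseInverse.exists A)

theorem moorePenroseInverse_spec {m n : Type*} [Fintype m] [Fintype n]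
    (A : Matrix m n ℝ) : IsMoorePenroseInverse A (moorePenroseInverse A) :=
  Classical.choose_spec (IsMoorePenroseInverse.exists A)

namespace SimpleGraph

/-- The resistance distance `(e_u - e_v)ᵀ L† (e_u - e_v)` between two vertices, where `L` is the
combinatorial Laplacian matrix of the graph and `L†` its Moore-Penrose inverse. -/
noncomputable def resistanceDist {V : Type*} [Fintype V] [DecidableEq V]
    (G : SimpleGraph V) [DecidableRel G.Adj] (u v : V) : ℝ :=
  let x : V → ℝ := Pi.single u 1 - Pi.single v 1
  x ⬝ᵥ (moorePenroseInverse (G.lapMatrix ℝ)).mulVec x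

/-- `F` is a spanning 2-forest of `G` separating `u` and `v`: a spanning forest of `G` with exactly
two components, such that `u` and `v` lie in distinct components. (A spanning subgraph of `G` is a
graph on the same vertex type with `F ≤ G`.) -/
structure IsSeparatingTwoForest {V : Type*} (G F : SimpleGraph V) (u v : V) : Prop where
  le : F ≤ G
  isAcyclic : F.IsAcyclic
  card_component : Nat.card F.ConnectedComponent = 2
  component_ne : F.connectedComponentMk u ≠ F.connectedComponentMk v

/-- The number of spanning 2-forests of `G` separating `u` and `v`. -/
noncomputable def separatingTwoForestCount {V : Type*} (G : SimpleGraph V) (u v : V) : ℕ :=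
  Set.ncard {F : SimpleGraph V | IsSeparatingTwoForest G F u v}

end SimpleGraph

/-- The vertices of the stage-`n` Sierpinski triangle, in barycentric coordinates scaled so that the
corners are `2 ^ n • eᵢ` and the smallest triangles have side `1`. Stage `n + 1` consists of three
translates of stage `n`, by `2 ^ n • e₀`, `2 ^ n • e₁` and `2 ^ n • e₂`; any two of
them share exactly one corner. -/
def sierpinskiVertices : ℕ → Finset (Fin 3 → ℕ)
  | 0 => Finset.univ.image fun i : Fin 3 => Pi.single i 1
  | n + 1 => Finset.univ.biUnion fun i : Fin 3 =>
      (sierpinskiVertices n).map (addRightEmbedding (Pi.single i (2 ^ n)))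

/-- The adjacency of the stage-`n` Sierpinski triangle, as a graph on all lattice points: stage `0`
is the triangle on `e₀, e₁, e₂`, and stage `n + 1` is the union of the three translates
of stage `n`. -/
def sierpinskiLattice : ℕ → SimpleGraph (Fin 3 → ℕ)
  | 0 => SimpleGraph.fromRel fun x y => x ∈ sierpinskiVertices 0 ∧ y ∈ sierpinskiVertices 0
  | n + 1 => ⨆ i : Fin 3,
      (sierpinskiLattice n).map (addRightEmbedding (Pi.single i (2 ^ n)))

/-- The stage-`n` Sierpinski triangle `S n`. -/
def sierpinskiTriangle (n : ℕ) : SimpleGraph (sierpinskiVertices n) :=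
  (sierpinskiLattice n).comap Subtype.val

noncomputable instance sierpinskiTriangle.decidableRelAdj (n : ℕ) :
    DecidableRel (sierpinskiTriangle n).Adj :=
  Classical.decRel _

/-!
The potential theory of the Sierpinski triangles gives both formulas.

*Resistance.* If `L φ = e_u - e_v`, then `r(u, v) = φ u - φ v`
(`SimpleGraph.resistanceDist_eq_of_lapMatrix_mulVec`), so it is enough to exhibit a potential. For
all values `p` at the corners of stage `n` there is a function that is harmonic elsewhere and whose
currents out of the corners are `(3 / 5) ^ n * (3 * p i - ∑ j, p j)`
(`Sierpinski.exists_isSierpinskiHarmonic`): seen from its corners, stage `n` is a triangle with edges of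
conductance `(3 / 5) ^ n`. The inductive step glues harmonic functions on the three copies, the
junction values being `(p i + p j + ∑ k, p k) / 5`.

*Forests.* Replace the rows of the Laplacian at a set `R` of roots by rows of the identity. The
determinant of this matrix counts the maps that send each non-root to a neighbour and lead every
vertex to a root (`SimpleGraph.det_dirichletMatrix`): expand each row `∑ (e_v - e_w)` by
multilinearity; a choice of neighbours contributes `1` if it leads to the roots and `0` otherwise.
For `R = {a, b}` these maps are the two-component forests separating `a` and `b`, oriented towards
`a` and `b` (`SimpleGraph.separatingTwoForestCount_eq_ncard`).

By Cramer's rule, declaring one more vertex `v` a root divides the determinant by the current out of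
`v` under the potential that is `1` at `v`, `0` at the other roots and harmonic elsewhere
(`SimpleGraph.det_dirichletMatrix_eq_mul_insert`). Let `D n` be the determinant with all three
corners of stage `n` as roots. Then the number of forests is `2 * (3 / 5) ^ n * D n`, and making the
three junctions of stage `n + 1` roots one after the other separates the interiors of the copies and
yields `D (n + 1) = 50 * (3 / 5) ^ (3 * n) * D n ^ 3` (`Sierpinski.sierpinskiDet_succ`).
-/

/-! ### Resistance distance from a potential -/

namespace SimpleGraph

open Matrix Finset

/-- A potential whose net current flow is a unit current from `u` to `v` computes the resistance
distance: `(L φ)ᵀ L† (L φ) = φᵀ L φ`, since `L` is symmetric and `L L† L = L`. -/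
theorem resistanceDist_eq_of_lapMatrix_mulVec {V : Type*} [Fintype V] [DecidableEq V]
    (G : SimpleGraph V) [DecidableRel G.Adj] {u v : V} {φ : V → ℝ}
    (h : G.lapMatrix ℝ *ᵥ φ = Pi.single u 1 - Pi.single v 1) :
    G.resistanceDist u v = φ u - φ v := by
  have hs : (G.lapMatrix ℝ)ᵀ = G.lapMatrix ℝ := G.isSymm_lapMatrix ℝ
  have key : G.resistanceDist u v
      = (G.lapMatrix ℝ *ᵥ φ) ⬝ᵥ moorePenroseInverse (G.lapMatrix ℝ) *ᵥ (G.lapMatrix ℝ *ᵥ φ) := by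
    rw [h]; rfl
  have h1 : (G.lapMatrix ℝ *ᵥ φ) = φ ᵥ* G.lapMatrix ℝ := by
    rw [← vecMul_transpose, hs]
  rw [key]
  nth_rewrite 1 [h1]
  rw [← dotProduct_mulVec, mulVec_mulVec, mulVec_mulVec,
    (moorePenroseInverse_spec (G.lapMatrix ℝ)).mul_mul_self, h]
  simp [dotProduct_sub]

/-! ### Rooting maps and two-component forests -/

/-- `f` sends every vertex outside the root set `R` to a neighbour, fixes the roots, and following
`f` leads from every vertex to a root. Such maps are the spanning forests of `G` with exactly one
root in each component, every edge being oriented towards the root. -/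
structure IsRootingMap {V : Type*} (G : SimpleGraph V) (R : Finset V) (f : V → V) : Prop where
  fixed : ∀ r ∈ R, f r = r
  adj : ∀ v ∉ R, G.Adj v (f v)
  reaches : ∀ v, ∃ k, f^[k] v ∈ R

/-- The graph with an edge between `v` and `f v` for each `v` that `f` moves. -/
def functionalGraph {V : Type*} (f : V → V) : SimpleGraph V :=
  fromRel fun v w => f v = w

theorem functionalGraph_adj {V : Type*} {f : V → V} {v w : V} :
    (functionalGraph f).Adj v w ↔ v ≠ w ∧ (f v = w ∨ f w = v) := by
  simp [functionalGraph]

theorem Reachable.iff_of_forall_adj {V : Type*} {G : SimpleGraph V} {P : V → Prop}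
    (hP : ∀ v w, G.Adj v w → (P v ↔ P w)) {u v : V} (h : G.Reachable u v) : P u ↔ P v := by
  obtain ⟨p⟩ := h
  induction p with
  | nil => rfl
  | cons hadj _ ih => exact (hP _ _ hadj).trans ih

namespace IsRootingMap

variable {V : Type*} {G : SimpleGraph V} {R : Finset V} {f g : V → V}

theorem iterate_fixed (hf : G.IsRootingMap R f) {r : V} (hr : r ∈ R) (k : ℕ) : f^[k] r = r :=
  Function.iterate_fixed (hf.fixed r hr) k

theorem iterate_succ_ne (hf : G.IsRootingMap R f) {v : V} (hv : v ∉ R) (k : ℕ) :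
    f^[k] (f v) ≠ v := by
  intro h
  obtain ⟨m, hm⟩ := hf.reaches v
  have hper : Function.IsPeriodicPt f (k + 1) v := h
  have h2 : f^[m * (k + 1)] v = v := hper.const_mul m
  have h3 : m * (k + 1) = m * k + m := by ring
  rw [h3, Function.iterate_add_apply, hf.iterate_fixed hm] at h2
  exact hv (h2 ▸ hm)

theorem functionalGraph_adj_apply (hf : G.IsRootingMap R f) {v : V} (hv : v ∉ R) :
    (functionalGraph f).Adj v (f v) :=
  functionalGraph_adj.2 ⟨fun h => hf.iterate_succ_ne hv 0 h.symm, Or.inl rfl⟩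

theorem functionalGraph_le (hf : G.IsRootingMap R f) : functionalGraph f ≤ G := by
  have key : ∀ v, v ≠ f v → G.Adj v (f v) := fun v hne =>
    hf.adj v fun hv => hne (hf.fixed v hv).symm
  intro v w h
  obtain ⟨hne, h | h⟩ := functionalGraph_adj.1 h
  · subst h; exact key v hne
  · subst h; exact (key w hne.symm).symm

/-- Deleting the edge from `v` to `f v` separates the vertices whose path to the root passes
through `v` from all others. -/
theorem isBridge (hf : G.IsRootingMap R f) {v : V} (hv : v ∉ R) :
    (functionalGraph f).IsBridge s(v, f v) := by
  rw [isBridge_iff]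
  intro h
  have step : ∀ x, x ≠ v → ((∃ k, f^[k] x = v) ↔ ∃ k, f^[k] (f x) = v) := by
    refine fun x hx => ⟨?_, fun ⟨k, hk⟩ => ⟨k + 1, hk⟩⟩
    rintro ⟨_ | k, hk⟩
    · exact absurd hk hx
    · exact ⟨k, hk⟩
  have := Reachable.iff_of_forall_adj (P := fun x => ∃ k, f^[k] x = v) ?_ h
  · obtain ⟨k, hk⟩ := this.1 ⟨0, rfl⟩
    exact hf.iterate_succ_ne hv k hk
  · intro x y hxy
    rw [deleteEdges_adj, functionalGraph_adj] at hxy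
    obtain ⟨⟨_, h | h⟩, hne⟩ := hxy
    · subst h
      exact step x fun h => hne (by simp [h])
    · subst h
      exact (step y fun h => hne (by simp [h, Sym2.eq_swap])).symm

theorem isAcyclic_functionalGraph (hf : G.IsRootingMap R f) : (functionalGraph f).IsAcyclic := by
  rw [isAcyclic_iff_forall_adj_isBridge]
  intro v w h
  obtain ⟨hne, h | h⟩ := functionalGraph_adj.1 h
  · subst h
    exact hf.isBridge fun hv => hne (hf.fixed v hv).symm
  · subst h
    rw [Sym2.eq_swap]
    exact hf.isBridge fun hv => hne (hf.fixed w hv)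

theorem reachable_iterate (hf : G.IsRootingMap R f) (k : ℕ) (v : V) :
    (functionalGraph f).Reachable v (f^[k] v) := by
  induction k generalizing v with
  | zero => rfl
  | succ k ih =>
    by_cases hv : v ∈ R
    · rw [hf.iterate_fixed hv]
    · exact (hf.functionalGraph_adj_apply hv).reachable.trans (ih (f v))

theorem eq_of_reachable (hf : G.IsRootingMap R f) {r s : V} (hr : r ∈ R) (hs : s ∈ R)
    (h : (functionalGraph f).Reachable r s) : r = s := by
  have step : ∀ x, (∃ k, f^[k] x = r) ↔ ∃ k, f^[k] (f x) = r := by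
    refine fun x => ⟨fun ⟨k, hk⟩ => ⟨k, ?_⟩, fun ⟨k, hk⟩ => ⟨k + 1, hk⟩⟩
    rw [← Function.iterate_succ_apply, Function.iterate_succ_apply', hk, hf.fixed r hr]
  have := Reachable.iff_of_forall_adj (P := fun x => ∃ k, f^[k] x = r) ?_ h
  · obtain ⟨k, hk⟩ := this.1 ⟨0, rfl⟩
    rw [← hk, hf.iterate_fixed hs]
  · intro x y hxy
    obtain ⟨_, h | h⟩ := functionalGraph_adj.1 hxy
    · subst h; exact step x
    · subst h; exact (step y).symm

/-- A rooting map is determined by its graph: where two such maps first differ, counting from the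
roots, one of them would have to run an edge in both directions. -/
theorem functionalGraph_injective (hf : G.IsRootingMap R f) (hg : G.IsRootingMap R g)
    (h : functionalGraph f = functionalGraph g) : f = g := by
  have key : ∀ k v, f^[k] v ∈ R → f v = g v := by
    intro k
    induction k with
    | zero => intro v hv; rw [hf.fixed v hv, hg.fixed v hv]
    | succ k ih =>
      intro v hk
      by_cases hv : v ∈ R
      · rw [hf.fixed v hv, hg.fixed v hv]
      · have hadj := hf.functionalGraph_adj_apply hv
        rw [h] at hadj
        obtain ⟨_, h1 | h1⟩ := functionalGraph_adj.1 hadj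
        · exact h1.symm
        · exact absurd ((ih (f v) hk).trans h1) (hf.iterate_succ_ne hv 1)
  funext v
  obtain ⟨k, hk⟩ := hf.reaches v
  exact key k v hk

variable [DecidableEq V] {a b : V}

theorem isSeparatingTwoForest (hf : G.IsRootingMap {a, b} f) (hab : a ≠ b) :
    IsSeparatingTwoForest G (functionalGraph f) a b := by
  have hne : (functionalGraph f).connectedComponentMk a ≠
      (functionalGraph f).connectedComponentMk b := fun h =>
    hab (hf.eq_of_reachable (by simp) (by simp) (ConnectedComponent.exact h))
  refine ⟨hf.functionalGraph_le, hf.isAcyclic_functionalGraph, ?_, hne⟩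
  refine Nat.card_eq_two_iff.2 ⟨_, _, hne, Set.eq_univ_of_forall fun c => ?_⟩
  induction c using ConnectedComponent.ind with | h v => ?_
  obtain ⟨k, hk⟩ := hf.reaches v
  have hr := ConnectedComponent.sound (hf.reachable_iterate k v)
  rcases Finset.mem_insert.1 hk with hk | hk
  · left; rw [hr, hk]
  · right; rw [hr, Finset.mem_singleton.1 hk]; rfl

end IsRootingMap

/-- Every separating two-component forest arises from a rooting map: each vertex is sent one step
along a shortest path to the root in its component. -/
theorem IsSeparatingTwoForest.exists_isRootingMap {V : Type*} [DecidableEq V]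
    {G F : SimpleGraph V} {a b : V} (hF : IsSeparatingTwoForest G F a b) :
    ∃ f, G.IsRootingMap {a, b} f ∧ functionalGraph f = F := by
  have hcov : ∀ v, F.Reachable v a ∨ F.Reachable v b := by
    intro v
    obtain ⟨y, -, hy⟩ := (Nat.card_eq_two_iff' (F.connectedComponentMk a)).1 hF.card_component
    by_cases h : F.connectedComponentMk v = F.connectedComponentMk a
    · exact Or.inl (ConnectedComponent.exact h)
    · exact Or.inr (ConnectedComponent.exact ((hy _ h).trans (hy _ hF.component_ne.symm).symm))
  have hab : ¬ F.Reachable a b := fun h => hF.component_ne (ConnectedComponent.sound h)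
  classical
  let ρ : V → V := fun v => if F.Reachable v a then a else b
  have hρ : ∀ v, F.Reachable v (ρ v) := by
    intro v
    by_cases h : F.Reachable v a
    · simp [ρ, h]
    · simpa [ρ, h] using (hcov v).resolve_left h
  have hρR : ∀ v, ρ v ∈ ({a, b} : Finset V) := by
    intro v; simp only [ρ]; split_ifs <;> simp
  have hρc : ∀ v w, F.Adj v w → ρ v = ρ w := by
    intro v w h
    have : F.Reachable v a ↔ F.Reachable w a :=
      ⟨fun h' => h.symm.reachable.trans h', fun h' => h.reachable.trans h'⟩
    simp [ρ, this]
  have hstep : ∀ v, ∃ w, (v ∈ ({a, b} : Finset V) → w = v) ∧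
      (v ∉ ({a, b} : Finset V) → F.Adj v w ∧ F.dist w (ρ w) < F.dist v (ρ v)) := by
    intro v
    by_cases hv : v ∈ ({a, b} : Finset V)
    · exact ⟨v, fun _ => rfl, fun h => absurd hv h⟩
    · obtain ⟨p, hp⟩ := (hρ v).exists_walk_length_eq_dist
      have hne : v ≠ ρ v := fun h => hv (h ▸ hρR v)
      obtain ⟨w, hvw, q, rfl⟩ := p.exists_eq_cons_of_ne hne
      refine ⟨w, fun h => absurd h hv, fun _ => ⟨hvw, ?_⟩⟩
      rw [← hρc v w hvw, ← hp, Walk.length_cons]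
      exact Nat.lt_succ_of_le (dist_le q)
  choose f hfix hf using hstep
  have hroot : G.IsRootingMap {a, b} f := by
    refine ⟨hfix, fun v hv => hF.le (hf v hv).1, fun v => ?_⟩
    induction hd : F.dist v (ρ v) using Nat.strong_induction_on generalizing v with
    | _ d ih =>
      by_cases hv : v ∈ ({a, b} : Finset V)
      · exact ⟨0, hv⟩
      · obtain ⟨k, hk⟩ := ih _ (hd ▸ (hf v hv).2) (f v) rfl
        exact ⟨k + 1, hk⟩
  have hle : functionalGraph f ≤ F := by
    have key : ∀ v, v ≠ f v → F.Adj v (f v) := fun v hne =>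
      (hf v fun hv => hne (hfix v hv).symm).1
    intro v w h
    obtain ⟨hne, h | h⟩ := functionalGraph_adj.1 h
    · subst h; exact key v hne
    · subst h; exact (key w hne.symm).symm
  refine ⟨f, hroot, le_antisymm hle fun x y hxy => ?_⟩
  -- An edge of `F` outside the functional graph would lie on a cycle of `F`, because its endpoints
  -- are already joined to the same root.
  by_contra hn
  have hto : ∀ v, (functionalGraph f).Reachable v (ρ v) := by
    intro v
    obtain ⟨k, hk⟩ := hroot.reaches v
    have hr := hroot.reachable_iterate k v
    have hrF := (hr.mono hle).symm.trans (hρ v)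
    generalize f^[k] v = z at hk hr hrF
    suffices z = ρ v from this ▸ hr
    have h1 := hρR v
    simp only [Finset.mem_insert, Finset.mem_singleton] at hk h1
    rcases hk with hk | hk <;> rcases h1 with h1 | h1 <;> rw [hk, h1] at hrF ⊢
    · exact absurd hrF hab
    · exact absurd hrF.symm hab
  have hxy' : (functionalGraph f).Reachable x y :=
    (hto x).trans (hρc x y hxy ▸ (hto y).symm)
  refine (isBridge_iff.1 (isAcyclic_iff_forall_adj_isBridge.1 hF.isAcyclic hxy)) (hxy'.mono ?_)
  intro u v huv
  refine (deleteEdges_adj).2 ⟨hle huv, fun h => hn ?_⟩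
  rw [Set.mem_singleton_iff, Sym2.eq_iff] at h
  rcases h with ⟨rfl, rfl⟩ | ⟨rfl, rfl⟩
  · exact huv
  · exact huv.symm

theorem separatingTwoForestCount_eq_ncard {V : Type*} [DecidableEq V] (G : SimpleGraph V)
    {a b : V} (hab : a ≠ b) :
    G.separatingTwoForestCount a b = Set.ncard {f | G.IsRootingMap {a, b} f} := by
  refine (Set.BijOn.ncard_eq (f := functionalGraph) ⟨?_, ?_, ?_⟩).symm
  · exact fun f hf => IsRootingMap.isSeparatingTwoForest hf hab
  · exact fun f hf g hg h => IsRootingMap.functionalGraph_injective hf hg h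
  · exact fun F hF => IsSeparatingTwoForest.exists_isRootingMap hF

/-! ### The Laplacian with Dirichlet conditions -/

section Dirichlet

variable {V : Type*} [Fintype V] [DecidableEq V] (G : SimpleGraph V) [DecidableRel G.Adj]

/-- The Laplacian matrix with the rows of the vertices in `R` replaced by those of the identity.
Its determinant is that of the Laplacian with the rows and columns in `R` deleted. -/
noncomputable def dirichletMatrix (R : Finset V) : Matrix V V ℝ :=
  of fun v => if v ∈ R then Pi.single v 1 else G.lapMatrix ℝ v

variable {G} {R : Finset V}

theorem dirichletMatrix_row_of_mem {v : V} (hv : v ∈ R) :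
    G.dirichletMatrix R v = Pi.single v 1 :=
  if_pos hv

theorem dirichletMatrix_row_of_notMem {v : V} (hv : v ∉ R) :
    G.dirichletMatrix R v = G.lapMatrix ℝ v :=
  if_neg hv

/-- Adding a root `v` divides the determinant by the current `α` that the potential `h` with
value `1` at `v` and `0` on the other roots sends out of `v`. -/
theorem det_dirichletMatrix_eq_mul_insert {v : V} (hv : v ∉ R) {h : V → ℝ} {α : ℝ}
    (hR : ∀ r ∈ R, h r = 0) (hv1 : h v = 1)
    (hL : ∀ u ∉ R, (G.lapMatrix ℝ *ᵥ h) u = if u = v then α else 0) :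
    (G.dirichletMatrix R).det = α * (G.dirichletMatrix (insert v R)).det := by
  have hM : G.dirichletMatrix R *ᵥ h = α • Pi.single v 1 := by
    funext u
    by_cases hu : u ∈ R
    · have : u ≠ v := fun e => hv (e ▸ hu)
      simp [mulVec, dirichletMatrix_row_of_mem hu, hR u hu, this]
    · have := hL u hu
      simp only [mulVec] at this ⊢
      rw [dirichletMatrix_row_of_notMem hu, this]
      by_cases huv : u = v
      · subst huv; simp
      · simp [huv]
  have hup : (G.dirichletMatrix R).updateRow v (Pi.single v 1) =
      G.dirichletMatrix (insert v R) := by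
    ext u w
    by_cases huv : u = v
    · subst huv; simp [dirichletMatrix]
    · simp [dirichletMatrix, huv]
  have := congrArg (fun x => ((G.dirichletMatrix R).adjugate *ᵥ x) v) hM
  simp only [mulVec_mulVec, adjugate_mul, smul_mulVec, one_mulVec, Pi.smul_apply, hv1,
    mulVec_smul, mulVec_single_one, col_apply, adjugate_apply, hup, smul_eq_mul, mul_one] at this
  exact this

/-- The matrix with rows `e_v - e_{f v}` off `R` and `e_v` on `R` has determinant `1` if `f` leads
every vertex to `R`, since it is triangular for the distance to `R`. Otherwise its determinant
vanishes: the indicator of the vertices that never reach `R` is in its kernel. -/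
theorem det_one_sub_shift (f : V → V) [Decidable (∀ v, ∃ k, f^[k] v ∈ R)] :
    (of fun v => if v ∈ R then (Pi.single v 1 : V → ℝ)
      else Pi.single v 1 - Pi.single (f v) 1).det =
      if ∀ v, ∃ k, f^[k] v ∈ R then 1 else 0 := by
  classical
  split_ifs with h
  · let d : V → ℕ := fun v => Nat.find (h v)
    have hd : ∀ v ∉ R, d (f v) < d v := by
      intro v hv
      have h0 : d v ≠ 0 := fun h0 => hv (by simpa [h0, d] using Nat.find_spec (h v))
      obtain ⟨k, hk⟩ := Nat.exists_eq_succ_of_ne_zero h0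
      have hs : f^[d v] v ∈ R := Nat.find_spec (h v)
      rw [hk] at hs ⊢
      exact Nat.lt_succ_of_le (Nat.find_min' (h (f v)) hs)
    have hentry : ∀ i j, d i ≤ d j → (of fun v => if v ∈ R then (Pi.single v 1 : V → ℝ)
        else Pi.single v 1 - Pi.single (f v) 1) i j = if i = j then 1 else 0 := by
      intro i j hij
      by_cases hi : i ∈ R
      · simp [hi, Pi.single_apply, eq_comm]
      · have : j ≠ f i := fun e => absurd (hd i hi) (by rw [← e]; exact not_lt.2 hij)
        simp [hi, Pi.single_apply, this, eq_comm]
    rw [BlockTriangular.det (b := OrderDual.toDual ∘ d)]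
    · refine Finset.prod_eq_one fun a _ => ?_
      refine (congrArg det ?_).trans det_one
      ext i j
      have hij : d i.1 ≤ d j.1 := (i.2.trans j.2.symm).ge
      rw [toSquareBlock_def, of_apply, hentry _ _ hij, one_apply]
      simp [Subtype.ext_iff]
    · intro i j hij
      have hlt : d i < d j := hij
      rw [hentry i j hlt.le, if_neg]
      rintro rfl
      exact lt_irrefl _ hlt
  · push Not at h
    obtain ⟨v₀, hv₀⟩ := h
    rw [← exists_mulVec_eq_zero_iff]
    refine ⟨fun v => if ∃ k, f^[k] v ∈ R then 0 else 1, fun h0 => ?_, ?_⟩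
    · have := congrFun h0 v₀
      rw [if_neg (by push Not; exact hv₀)] at this
      exact one_ne_zero this
    · funext v
      by_cases hv : v ∈ R
      · have : ∃ k, f^[k] v ∈ R := ⟨0, hv⟩
        simp [mulVec, hv, this]
      · have : (∃ k, f^[k] v ∈ R) ↔ ∃ k, f^[k] (f v) ∈ R := by
          refine ⟨?_, fun ⟨k, hk⟩ => ⟨k + 1, hk⟩⟩
          rintro ⟨_ | k, hk⟩
          · exact absurd hk hv
          · exact ⟨k, hk⟩
        simp only [mulVec, of_apply, hv, if_false, sub_dotProduct, single_dotProduct, one_mul, this]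
        simp

theorem lapMatrix_row (v : V) :
    G.lapMatrix ℝ v = ∑ w ∈ G.neighborFinset v, (Pi.single v 1 - Pi.single w 1) := by
  funext u
  simp [lapMatrix, degMatrix, diagonal_apply, Finset.sum_apply, Pi.single_apply, adjMatrix_apply,
    Finset.sum_sub_distrib, eq_comm]

/-- The matrix-forest theorem: expanding each Laplacian row as a sum over the neighbours writes
the determinant as a sum over all choices of a neighbour for each non-root, in which precisely the
rooting maps contribute `1`. -/
theorem det_dirichletMatrix (R : Finset V) :
    (G.dirichletMatrix R).det = (Set.ncard {f | G.IsRootingMap R f} : ℝ) := by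
  classical
  let A : V → Finset V := fun v => if v ∈ R then {v} else G.neighborFinset v
  let g : V → V → V → ℝ := fun v w =>
    if v ∈ R then Pi.single v 1 else Pi.single v 1 - Pi.single w 1
  have h1 : G.dirichletMatrix R = fun v => ∑ w ∈ A v, g v w := by
    funext v
    by_cases hv : v ∈ R
    · simp [A, g, dirichletMatrix_row_of_mem hv, hv]
    · simp [A, g, dirichletMatrix_row_of_notMem hv, hv, lapMatrix_row]
  have h2 : (G.dirichletMatrix R).det =
      ∑ f ∈ Fintype.piFinset A, (of fun v => if v ∈ R then (Pi.single v 1 : V → ℝ)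
        else Pi.single v 1 - Pi.single (f v) 1).det := by
    rw [h1]
    exact (detRowAlternating (n := V) (R := ℝ)).toMultilinearMap.map_sum_finset g A
  have hA : ∀ f ∈ Fintype.piFinset A, ∀ r ∈ R, f r = r := by
    intro f hf r hr
    have := Fintype.mem_piFinset.1 hf r
    simpa [A, hr] using this
  rw [h2, Finset.sum_congr rfl fun f _ => det_one_sub_shift (R := R) f,
    Finset.sum_boole, ← Set.ncard_coe_finset]
  congr 2
  ext f
  simp only [Finset.coe_filter, Set.mem_ofPred_eq]
  constructor
  · rintro ⟨hf, hr⟩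
    refine ⟨hA f hf, fun v hv => ?_, hr⟩
    simpa [A, hv] using Fintype.mem_piFinset.1 hf v
  · intro hf
    refine ⟨Fintype.mem_piFinset.2 fun v => ?_, hf.reaches⟩
    by_cases hv : v ∈ R
    · simp [A, hv, hf.fixed v hv]
    · simpa [A, hv] using hf.adj v hv

theorem separatingTwoForestCount_eq_det {a b : V} (hab : a ≠ b) :
    (G.separatingTwoForestCount a b : ℝ) = (G.dirichletMatrix {a, b}).det := by
  rw [det_dirichletMatrix, separatingTwoForestCount_eq_ncard G hab]

theorem det_dirichletMatrix_eq_det_lapMatrix (R : Finset V) :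
    (G.dirichletMatrix R).det =
      ((G.lapMatrix ℝ).submatrix (fun v : {v // v ∉ R} => v.1) fun v => v.1).det := by
  rw [twoBlockTriangular_det' _ (· ∈ R)]
  · have h1 : toSquareBlockProp (G.dirichletMatrix R) (· ∈ R) = 1 := by
      ext i j
      rw [toSquareBlockProp_def, of_apply, dirichletMatrix_row_of_mem i.2, one_apply,
        Pi.single_apply]
      exact if_congr (by rw [Subtype.ext_iff, eq_comm]) rfl rfl
    rw [h1]
    simp only [det_one, one_mul]
    congr 1
    ext i j
    rw [toSquareBlockProp_def, of_apply, dirichletMatrix_row_of_notMem i.2, submatrix_apply]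
  · intro i hi j hj
    rw [dirichletMatrix_row_of_mem hi, Pi.single_apply, if_neg]
    rintro rfl
    exact hj hi

end Dirichlet

end SimpleGraph

/-! ### Vertices and edges of the Sierpinski triangles -/

namespace Sierpinski

open Matrix Finset SimpleGraph

/-- The `i`-th corner of stage `n`, which is also the vector by which the `i`-th copy of stage `n`
is translated inside stage `n + 1`. -/
def sierpinskiCorner (n : ℕ) (i : Fin 3) : Fin 3 → ℕ := Pi.single i (2 ^ n)

/-- A vertex of stage `n` other than the three corners. -/
def IsSierpinskiInterior (n : ℕ) (x : Fin 3 → ℕ) : Prop :=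
  x ∈ sierpinskiVertices n ∧ ∀ j, x ≠ sierpinskiCorner n j

local notation "𝐜" => sierpinskiCorner

variable {n : ℕ} {i j : Fin 3} {x y z : Fin 3 → ℕ}

theorem mem_sierpinskiVertices_succ :
    z ∈ sierpinskiVertices (n + 1) ↔ ∃ i, ∃ y ∈ sierpinskiVertices n, y + 𝐜 n i = z := by
  simp [sierpinskiVertices, sierpinskiCorner]

theorem add_corner_mem (hx : x ∈ sierpinskiVertices n) (i : Fin 3) :
    x + 𝐜 n i ∈ sierpinskiVertices (n + 1) :=
  mem_sierpinskiVertices_succ.2 ⟨i, x, hx, rfl⟩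

theorem corner_add_self (n : ℕ) (i : Fin 3) : 𝐜 n i + 𝐜 n i = 𝐜 (n + 1) i := by
  rw [sierpinskiCorner, sierpinskiCorner, ← Pi.single_add, pow_succ, mul_two]

theorem corner_mem (n : ℕ) (i : Fin 3) : 𝐜 n i ∈ sierpinskiVertices n := by
  induction n with
  | zero => simp [sierpinskiVertices, sierpinskiCorner]
  | succ n ih => exact corner_add_self n i ▸ add_corner_mem ih i

theorem corner_injective (n : ℕ) : Function.Injective (𝐜 n) := by
  intro i j h
  by_contra hij
  have := congrFun h i
  simp [sierpinskiCorner, hij] at this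

theorem sum_eq_of_mem_sierpinskiVertices (hx : x ∈ sierpinskiVertices n) :
    ∑ k, x k = 2 ^ n := by
  induction n generalizing x with
  | zero =>
    obtain ⟨i, rfl⟩ : ∃ i : Fin 3, Pi.single i 1 = x := by simpa [sierpinskiVertices] using hx
    simp
  | succ n ih =>
    obtain ⟨i, y, hy, rfl⟩ := mem_sierpinskiVertices_succ.1 hx
    simp [Finset.sum_add_distrib, ih hy, sierpinskiCorner, pow_succ, mul_two]

theorem exists_eq_corner_of_mem_zero (hx : x ∈ sierpinskiVertices 0) : ∃ i, x = 𝐜 0 i := by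
  simpa [sierpinskiVertices, sierpinskiCorner, eq_comm] using hx

theorem eq_corner_of_le (hx : x ∈ sierpinskiVertices n) (h : 2 ^ n ≤ x i) : x = 𝐜 n i := by
  have hs := sum_eq_of_mem_sierpinskiVertices hx
  rw [← Finset.add_sum_erase _ _ (mem_univ i)] at hs
  have h0 : ∑ k ∈ univ.erase i, x k = 0 := by omega
  rw [Finset.sum_eq_zero_iff] at h0
  funext k
  by_cases hk : k = i
  · subst hk; simp [sierpinskiCorner]; omega
  · simp [sierpinskiCorner, hk, h0 k (by simp [hk])]

/-- Two different copies of stage `n` in stage `n + 1` share a single vertex. -/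
theorem eq_corner_of_add_eq_add (hij : i ≠ j) (hx : x ∈ sierpinskiVertices n)
    (h : x + 𝐜 n i = y + 𝐜 n j) : x = 𝐜 n j := by
  refine eq_corner_of_le hx ?_
  have := congrFun h j
  simp [sierpinskiCorner, hij.symm] at this
  omega

theorem IsSierpinskiInterior.eq_of_add_eq_add (hx : IsSierpinskiInterior n x)
    (h : x + 𝐜 n i = y + 𝐜 n j) : i = j := by
  by_contra hij
  exact hx.2 j (eq_corner_of_add_eq_add hij hx.1 h)

theorem IsSierpinskiInterior.add_corner_ne (hx : IsSierpinskiInterior n x) (i j k : Fin 3) :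
    x + 𝐜 n i ≠ 𝐜 n j + 𝐜 n k := by
  intro h
  obtain rfl := hx.eq_of_add_eq_add h
  exact hx.2 j (add_right_cancel h)

theorem sierpinskiVertices_succ_cases (hz : z ∈ sierpinskiVertices (n + 1)) :
    (∃ i, z = 𝐜 (n + 1) i) ∨ (∃ i j, i ≠ j ∧ z = 𝐜 n i + 𝐜 n j) ∨
      ∃ i y, IsSierpinskiInterior n y ∧ z = y + 𝐜 n i := by
  obtain ⟨i, y, hy, rfl⟩ := mem_sierpinskiVertices_succ.1 hz
  by_cases h : ∃ j, y = 𝐜 n j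
  · obtain ⟨j, rfl⟩ := h
    by_cases hij : j = i
    · subst hij; exact Or.inl ⟨j, corner_add_self n j⟩
    · exact Or.inr (Or.inl ⟨j, i, hij, rfl⟩)
  · push Not at h
    exact Or.inr (Or.inr ⟨i, y, ⟨hy, h⟩, rfl⟩)

theorem sierpinskiLattice_zero_adj : (sierpinskiLattice 0).Adj x y ↔
    x ≠ y ∧ x ∈ sierpinskiVertices 0 ∧ y ∈ sierpinskiVertices 0 := by
  rw [sierpinskiLattice, fromRel_adj]
  tauto

theorem sierpinskiLattice_succ_adj : (sierpinskiLattice (n + 1)).Adj x y ↔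
    ∃ i x' y', (sierpinskiLattice n).Adj x' y' ∧ x' + 𝐜 n i = x ∧ y' + 𝐜 n i = y := by
  simp only [sierpinskiLattice, iSup_adj, map_adj]
  rfl

theorem mem_of_sierpinskiLattice_adj (h : (sierpinskiLattice n).Adj x y) :
    x ∈ sierpinskiVertices n := by
  induction n generalizing x y with
  | zero => exact (sierpinskiLattice_zero_adj.1 h).2.1
  | succ n ih =>
    obtain ⟨i, x', y', h', rfl, rfl⟩ := sierpinskiLattice_succ_adj.1 h
    exact add_corner_mem (ih h') i

open Classical in
/-- The neighbours of `x` in stage `n`, as lattice points. -/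
noncomputable def sierpinskiNeighbors (n : ℕ) (x : Fin 3 → ℕ) : Finset (Fin 3 → ℕ) :=
  (sierpinskiVertices n).filter fun y => (sierpinskiLattice n).Adj x y

theorem mem_sierpinskiNeighbors :
    y ∈ sierpinskiNeighbors n x ↔ (sierpinskiLattice n).Adj x y := by
  simp only [sierpinskiNeighbors, mem_filter, and_iff_right_iff_imp]
  exact fun h => mem_of_sierpinskiLattice_adj h.symm

/-- A vertex lying in the `i`-th copy only has all its neighbours in that copy. -/
theorem sierpinskiNeighbors_add_corner (h : ∀ j, j ≠ i → x ≠ 𝐜 n j) :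
    sierpinskiNeighbors (n + 1) (x + 𝐜 n i) =
      (sierpinskiNeighbors n x).map (addRightEmbedding (𝐜 n i)) := by
  ext z
  simp only [mem_sierpinskiNeighbors, sierpinskiLattice_succ_adj, mem_map, addRightEmbedding_apply]
  constructor
  · rintro ⟨j, x', y', hadj, hx', rfl⟩
    by_cases hij : j = i
    · subst hij
      obtain rfl := add_right_cancel hx'
      exact ⟨y', hadj, rfl⟩
    · have h1 := eq_corner_of_add_eq_add hij (mem_of_sierpinskiLattice_adj hadj) hx'
      refine absurd ?_ (h j hij)
      rw [h1, add_comm] at hx'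
      exact (add_right_cancel hx').symm
  · rintro ⟨y, hadj, rfl⟩
    exact ⟨i, x, y, hadj, rfl, rfl⟩

/-- The neighbours of a junction come from both copies that meet there. -/
theorem sierpinskiNeighbors_junction (hij : i ≠ j) :
    sierpinskiNeighbors (n + 1) (𝐜 n i + 𝐜 n j) =
      (sierpinskiNeighbors n (𝐜 n i)).map (addRightEmbedding (𝐜 n j)) ∪
        (sierpinskiNeighbors n (𝐜 n j)).map (addRightEmbedding (𝐜 n i)) := by
  ext z
  simp only [mem_sierpinskiNeighbors, sierpinskiLattice_succ_adj, mem_map, addRightEmbedding_apply,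
    mem_union]
  constructor
  · rintro ⟨k, x', y', hadj, hx', rfl⟩
    by_cases hkj : k = j
    · subst hkj
      obtain rfl := add_right_cancel hx'
      exact Or.inl ⟨y', hadj, rfl⟩
    · have h1 := eq_corner_of_add_eq_add hkj (mem_of_sierpinskiLattice_adj hadj) hx'
      rw [h1, add_comm] at hx'
      obtain rfl := corner_injective n (add_right_cancel hx')
      exact Or.inr ⟨y', h1 ▸ hadj, rfl⟩
  · rintro (⟨y, hadj, rfl⟩ | ⟨y, hadj, rfl⟩)
    · exact ⟨j, _, y, hadj, rfl, rfl⟩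
    · exact ⟨i, _, y, hadj, add_comm _ _, rfl⟩

theorem disjoint_sierpinskiNeighbors_junction (hij : i ≠ j) :
    Disjoint ((sierpinskiNeighbors n (𝐜 n i)).map (addRightEmbedding (𝐜 n j)))
      ((sierpinskiNeighbors n (𝐜 n j)).map (addRightEmbedding (𝐜 n i))) := by
  rw [Finset.disjoint_left]
  intro z hz hz'
  obtain ⟨y, hy, rfl⟩ := mem_map.1 hz
  obtain ⟨y', hy', h⟩ := mem_map.1 hz'
  rw [mem_sierpinskiNeighbors] at hy hy'
  have := eq_corner_of_add_eq_add hij (mem_of_sierpinskiLattice_adj hy'.symm) h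
  exact hy'.ne this.symm

theorem card_sierpinskiNeighbors_corner (n : ℕ) (i : Fin 3) :
    (sierpinskiNeighbors n (𝐜 n i)).card = 2 := by
  induction n with
  | zero =>
    have : sierpinskiNeighbors 0 (𝐜 0 i) = (sierpinskiVertices 0).erase (𝐜 0 i) := by
      ext y
      have := corner_mem 0 i
      rw [mem_sierpinskiNeighbors, sierpinskiLattice_zero_adj, mem_erase]
      tauto
    rw [this, card_erase_of_mem (corner_mem 0 i)]
    rfl
  | succ n ih =>
    rw [← corner_add_self, sierpinskiNeighbors_add_corner fun j hj h =>
      hj (corner_injective n h).symm, card_map, ih]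

theorem IsSierpinskiInterior.card_sierpinskiNeighbors (hx : IsSierpinskiInterior n x) :
    (sierpinskiNeighbors n x).card = 4 := by
  induction n generalizing x with
  | zero =>
    obtain ⟨i, hi⟩ := exists_eq_corner_of_mem_zero hx.1
    exact absurd hi (hx.2 i)
  | succ n ih =>
    rcases sierpinskiVertices_succ_cases hx.1 with ⟨i, rfl⟩ | ⟨i, j, hij, rfl⟩ | ⟨i, y, hy, rfl⟩
    · exact absurd rfl (hx.2 i)
    · rw [sierpinskiNeighbors_junction hij,
        card_union_of_disjoint (disjoint_sierpinskiNeighbors_junction hij), card_map, card_map,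
        card_sierpinskiNeighbors_corner, card_sierpinskiNeighbors_corner]
    · rw [sierpinskiNeighbors_add_corner fun j _ => hy.2 j, card_map, ih hy]

/-! ### Harmonic functions on the Sierpinski triangles -/

/-- The net current `∑ (h x - h y)` out of `x` in stage `n` under the potential `h`, the sum
running over the neighbours `y` of `x`. -/
noncomputable def sierpinskiCurrent (n : ℕ) (h : (Fin 3 → ℕ) → ℝ) (x : Fin 3 → ℕ) : ℝ :=
  ∑ y ∈ sierpinskiNeighbors n x, (h x - h y)

theorem sierpinskiCurrent_congr {h h' : (Fin 3 → ℕ) → ℝ}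
    (H : ∀ y ∈ sierpinskiVertices n, h y = h' y) (hx : x ∈ sierpinskiVertices n) :
    sierpinskiCurrent n h x = sierpinskiCurrent n h' x := by
  refine Finset.sum_congr rfl fun y hy => ?_
  rw [H x hx, H y (mem_of_sierpinskiLattice_adj (mem_sierpinskiNeighbors.1 hy).symm)]

theorem sierpinskiCurrent_add_corner (H : (Fin 3 → ℕ) → ℝ) (h : ∀ j, j ≠ i → x ≠ 𝐜 n j) :
    sierpinskiCurrent (n + 1) H (x + 𝐜 n i) =
      sierpinskiCurrent n (fun y => H (y + 𝐜 n i)) x := by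
  rw [sierpinskiCurrent, sierpinskiNeighbors_add_corner h, sum_map]
  rfl

theorem sierpinskiCurrent_junction (H : (Fin 3 → ℕ) → ℝ) (hij : i ≠ j) :
    sierpinskiCurrent (n + 1) H (𝐜 n i + 𝐜 n j) =
      sierpinskiCurrent n (fun y => H (y + 𝐜 n j)) (𝐜 n i) +
        sierpinskiCurrent n (fun y => H (y + 𝐜 n i)) (𝐜 n j) := by
  rw [sierpinskiCurrent, sierpinskiNeighbors_junction hij,
    sum_union (disjoint_sierpinskiNeighbors_junction hij), sum_map, sum_map]
  simp only [sierpinskiCurrent, addRightEmbedding_apply, add_comm (𝐜 n j) (𝐜 n i)]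

theorem exists_glued_function (n : ℕ) (h : Fin 3 → (Fin 3 → ℕ) → ℝ)
    (hh : ∀ i j, h i (𝐜 n j) = h j (𝐜 n i)) :
    ∃ H : (Fin 3 → ℕ) → ℝ, ∀ i, ∀ x ∈ sierpinskiVertices n, H (x + 𝐜 n i) = h i x := by
  classical
  refine ⟨fun z => if hz : z ∈ sierpinskiVertices (n + 1) then
    h (mem_sierpinskiVertices_succ.1 hz).choose
      (mem_sierpinskiVertices_succ.1 hz).choose_spec.choose else 0, fun i x hx => ?_⟩
  have hz := add_corner_mem hx i
  beta_reduce
  rw [dif_pos hz]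
  have hspec := (mem_sierpinskiVertices_succ.1 hz).choose_spec.choose_spec
  generalize (mem_sierpinskiVertices_succ.1 hz).choose_spec.choose = y at hspec
  generalize (mem_sierpinskiVertices_succ.1 hz).choose = k at hspec
  obtain ⟨hy, he⟩ := hspec
  by_cases hki : k = i
  · subst hki; rw [add_right_cancel he]
  · rw [eq_corner_of_add_eq_add hki hy he, eq_corner_of_add_eq_add (Ne.symm hki) hx he.symm, hh]

/-- `h` has the values `p` at the corners of stage `n` and is harmonic elsewhere; the currents out
of the corners are those of a triangle whose edges have conductance `(3 / 5) ^ n`. -/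
structure IsSierpinskiHarmonic (n : ℕ) (p : Fin 3 → ℝ) (h : (Fin 3 → ℕ) → ℝ) : Prop where
  corner : ∀ i, h (𝐜 n i) = p i
  current_corner : ∀ i, sierpinskiCurrent n h (𝐜 n i) = (3 / 5) ^ n * (3 * p i - ∑ j, p j)
  current_interior : ∀ x, IsSierpinskiInterior n x → sierpinskiCurrent n h x = 0

/-- Harmonic functions on the three copies with matching values `q i j = q j i` at the junctions
(and `q i i` at the corners) glue; at each junction the currents of two copies add up. -/
theorem exists_glued_harmonic (ih : ∀ p, ∃ h, IsSierpinskiHarmonic n p h) (q : Fin 3 → Fin 3 → ℝ)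
    (hq : ∀ i j, q i j = q j i) :
    ∃ H : (Fin 3 → ℕ) → ℝ, (∀ i j, H (𝐜 n i + 𝐜 n j) = q i j) ∧
      (∀ i, sierpinskiCurrent (n + 1) H (𝐜 (n + 1) i) =
        (3 / 5) ^ n * (3 * q i i - ∑ k, q i k)) ∧
      (∀ i j, i ≠ j → sierpinskiCurrent (n + 1) H (𝐜 n i + 𝐜 n j) =
        (3 / 5) ^ n * ((3 * q i j - ∑ k, q i k) + (3 * q i j - ∑ k, q j k))) ∧
      ∀ i x, IsSierpinskiInterior n x → sierpinskiCurrent (n + 1) H (x + 𝐜 n i) = 0 := by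
  choose h hh using fun i => ih (q i)
  obtain ⟨H, hH⟩ := exists_glued_function n h fun i j => by
    rw [(hh i).corner, (hh j).corner, hq]
  have hcur : ∀ i, ∀ x ∈ sierpinskiVertices n,
      sierpinskiCurrent n (fun y => H (y + 𝐜 n i)) x = sierpinskiCurrent n (h i) x :=
    fun i x hx => sierpinskiCurrent_congr (fun y hy => hH i y hy) hx
  refine ⟨H, fun i j => ?_, fun i => ?_, fun i j hij => ?_, fun i x hx => ?_⟩
  · rw [hH j _ (corner_mem n i), (hh j).corner, hq]
  · rw [← corner_add_self, sierpinskiCurrent_add_corner H fun j hj h =>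
      hj (corner_injective n h).symm, hcur _ _ (corner_mem n i), (hh i).current_corner]
  · rw [sierpinskiCurrent_junction H hij, hcur _ _ (corner_mem n i), hcur _ _ (corner_mem n j),
      (hh i).current_corner, (hh j).current_corner, hq j i]
    ring
  · rw [sierpinskiCurrent_add_corner H fun j _ => hx.2 j, hcur _ _ hx.1,
      (hh i).current_interior x hx]

theorem exists_isSierpinskiHarmonic (n : ℕ) (p : Fin 3 → ℝ) :
    ∃ h, IsSierpinskiHarmonic n p h := by
  induction n generalizing p with
  | zero =>
    have hN : ∀ i, sierpinskiNeighbors 0 (𝐜 0 i) = (univ.erase i).image (𝐜 0) := by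
      intro i
      ext y
      rw [mem_sierpinskiNeighbors, sierpinskiLattice_zero_adj]
      simp only [mem_image, mem_erase, mem_univ, and_true, sierpinskiVertices, true_and]
      constructor
      · rintro ⟨hne, -, j, rfl⟩
        exact ⟨j, fun e => hne (by subst e; rfl), rfl⟩
      · rintro ⟨j, hj, rfl⟩
        exact ⟨fun e => hj (corner_injective 0 e).symm, ⟨i, rfl⟩, ⟨j, rfl⟩⟩
    -- At stage `0` the barycentric coordinates interpolate the corner values.
    refine ⟨fun x => ∑ i, x i * p i, ?_, ?_, ?_⟩
    · intro i; simp [sierpinskiCorner, Pi.single_apply]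
    · intro i
      rw [sierpinskiCurrent, hN, sum_image (corner_injective 0).injOn]
      rw [← Finset.add_sum_erase univ p (mem_univ i)]
      simp [sierpinskiCorner, Pi.single_apply]
      ring
    · intro x hx
      obtain ⟨i, hi⟩ := exists_eq_corner_of_mem_zero hx.1
      exact absurd hi (hx.2 i)
  | succ n ih =>
    -- The junction values solve the `3 × 3` system saying that no current leaves the junctions.
    obtain ⟨H, h1, h2, h3, h4⟩ := exists_glued_harmonic ih
      (fun i j => if i = j then p i else (p i + p j + ∑ k, p k) / 5) fun i j => by
        by_cases hij : i = j
        · subst hij; rfl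
        · simp only [hij, Ne.symm hij, if_false]; ring
    refine ⟨H, fun i => ?_, fun i => ?_, fun x hx => ?_⟩
    · rw [← corner_add_self, h1, if_pos rfl]
    · rw [h2, pow_succ]
      fin_cases i <;> simp [Fin.sum_univ_three] <;> ring
    · rcases sierpinskiVertices_succ_cases hx.1 with ⟨i, rfl⟩ | ⟨i, j, hij, rfl⟩ | ⟨i, y, hy, rfl⟩
      · exact absurd rfl (hx.2 i)
      · rw [h3 i j hij, mul_eq_zero]
        right
        fin_cases i <;> fin_cases j <;> simp [Fin.sum_univ_three] at hij ⊢ <;> ring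
      · exact h4 i y hy

/-- The junction of stage `n + 1` opposite to its `k`-th corner. -/
def sierpinskiJunction (n : ℕ) (k : Fin 3) : Fin 3 → ℕ := 𝐜 n (k + 1) + 𝐜 n (k + 2)

theorem exists_eq_sierpinskiJunction (n : ℕ) (hij : i ≠ j) :
    ∃ k, 𝐜 n i + 𝐜 n j = sierpinskiJunction n k := by
  have : ∃ k, (i = k + 1 ∧ j = k + 2) ∨ (i = k + 2 ∧ j = k + 1) := by
    revert i j; decide
  obtain ⟨k, ⟨rfl, rfl⟩ | ⟨rfl, rfl⟩⟩ := this
  · exact ⟨k, rfl⟩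
  · exact ⟨k, add_comm _ _⟩

/-- The potential on stage `n + 1` that vanishes at the corners, takes the values `t` at the
junctions and is harmonic inside each copy. -/
theorem exists_junction_potential (n : ℕ) (t : Fin 3 → ℝ) :
    ∃ H : (Fin 3 → ℕ) → ℝ, (∀ i, H (𝐜 (n + 1) i) = 0) ∧
      (∀ k, H (sierpinskiJunction n k) = t k) ∧
      (∀ k, sierpinskiCurrent (n + 1) H (sierpinskiJunction n k) =
        (3 / 5) ^ n * (5 * t k - ∑ l, t l)) ∧
      ∀ i x, IsSierpinskiInterior n x → sierpinskiCurrent (n + 1) H (x + 𝐜 n i) = 0 := by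
  -- In `Fin 3`, the index different from `i ≠ j` is `-(i + j)`.
  obtain ⟨H, h1, -, h3, h4⟩ := exists_glued_harmonic (exists_isSierpinskiHarmonic n)
    (fun i j => if i = j then 0 else t (-(i + j))) fun i j => by
      rw [add_comm]; simp only [eq_comm]
  refine ⟨H, fun i => ?_, fun k => ?_, fun k => ?_, h4⟩
  · rw [← corner_add_self, h1, if_pos rfl]
  · rw [sierpinskiJunction, h1]
    fin_cases k <;> rfl
  · rw [sierpinskiJunction, h3 _ _ (by fin_cases k <;> decide)]
    have e1 : (-1 : Fin 3) = 2 := rfl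
    have e2 : (-2 : Fin 3) = 1 := rfl
    have e3 : (1 + 2 : Fin 3) = 0 := rfl
    have e4 : (2 + 1 : Fin 3) = 0 := rfl
    fin_cases k <;> simp [Fin.sum_univ_three, e1, e2, e3, e4] <;> ring

theorem sierpinskiJunction_mem (n : ℕ) (k : Fin 3) :
    sierpinskiJunction n k ∈ sierpinskiVertices (n + 1) :=
  add_corner_mem (corner_mem n _) _

theorem sierpinskiJunction_apply_self (n : ℕ) (k : Fin 3) : sierpinskiJunction n k k = 0 := by
  fin_cases k <;> simp [sierpinskiJunction, sierpinskiCorner]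

theorem sierpinskiJunction_apply_of_ne (n : ℕ) {k l : Fin 3} (h : l ≠ k) :
    sierpinskiJunction n k l = 2 ^ n := by
  fin_cases k <;> fin_cases l <;> simp [sierpinskiJunction, sierpinskiCorner] at h ⊢

theorem sierpinskiJunction_injective (n : ℕ) : Function.Injective (sierpinskiJunction n) := by
  intro k l h
  by_contra hkl
  have := congrFun h k
  rw [sierpinskiJunction_apply_self, sierpinskiJunction_apply_of_ne n hkl] at this
  exact absurd this.symm (by positivity)

theorem sierpinskiJunction_ne_corner (n : ℕ) (k i : Fin 3) :
    sierpinskiJunction n k ≠ 𝐜 (n + 1) i := by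
  intro h
  obtain ⟨l, hlk, hli⟩ : ∃ l, l ≠ k ∧ l ≠ i := by
    clear h; revert k i; decide
  have := congrFun h l
  rw [sierpinskiJunction_apply_of_ne n hlk] at this
  simp [sierpinskiCorner, hli] at this

/-! ### Laplacian determinants of the Sierpinski triangles -/

theorem sierpinskiTriangle_neighborFinset (v : sierpinskiVertices n) :
    ((sierpinskiTriangle n).neighborFinset v).map (Function.Embedding.subtype _) =
      sierpinskiNeighbors n v.1 := by
  ext y
  simp only [mem_map, mem_neighborFinset, Function.Embedding.subtype_apply,
    mem_sierpinskiNeighbors]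
  constructor
  · rintro ⟨w, hw, rfl⟩; exact hw
  · exact fun h => ⟨⟨y, mem_of_sierpinskiLattice_adj h.symm⟩, h, rfl⟩

theorem sierpinskiTriangle_degree (v : sierpinskiVertices n) :
    (sierpinskiTriangle n).degree v = (sierpinskiNeighbors n v.1).card := by
  rw [← sierpinskiTriangle_neighborFinset, card_map, card_neighborFinset_eq_degree]

theorem exists_eq_corner_of_degree_eq_two (v : sierpinskiVertices n)
    (hv : (sierpinskiTriangle n).degree v = 2) : ∃ i, v = ⟨𝐜 n i, corner_mem n i⟩ := by
  by_contra! h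
  have : IsSierpinskiInterior n v.1 := ⟨v.2, fun i e => h i (Subtype.ext e)⟩
  rw [sierpinskiTriangle_degree, this.card_sierpinskiNeighbors] at hv
  omega

theorem sierpinskiTriangle_lapMatrix_mulVec (h : (Fin 3 → ℕ) → ℝ) (v : sierpinskiVertices n) :
    ((sierpinskiTriangle n).lapMatrix ℝ *ᵥ fun w => h w.1) v = sierpinskiCurrent n h v.1 := by
  rw [lapMatrix_mulVec_apply, sierpinskiCurrent, sum_sub_distrib, sum_const, nsmul_eq_mul,
    sierpinskiTriangle_degree, ← sierpinskiTriangle_neighborFinset, sum_map]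
  rfl

theorem sierpinskiTriangle_resistanceDist (hij : i ≠ j) :
    (sierpinskiTriangle n).resistanceDist ⟨𝐜 n i, corner_mem n i⟩ ⟨𝐜 n j, corner_mem n j⟩ =
      2 / 3 * (5 / 3) ^ n := by
  -- Corner values `t`, `-t`, `0` drive the current `3 * t * (3 / 5) ^ n = 1` from `i` to `j`.
  set t : ℝ := (5 / 3) ^ n / 3 with ht
  obtain ⟨h, hh⟩ := exists_isSierpinskiHarmonic n (Pi.single i t - Pi.single j t)
  have hpow : ((3 : ℝ) / 5) ^ n * (5 / 3) ^ n = 1 := by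
    rw [← mul_pow]; norm_num
  rw [resistanceDist_eq_of_lapMatrix_mulVec (sierpinskiTriangle n) (φ := fun w => h w.1)]
  · rw [hh.corner, hh.corner]
    simp [hij, hij.symm, ht]
    ring
  · funext v
    rw [sierpinskiTriangle_lapMatrix_mulVec]
    by_cases hv : ∃ k, v = ⟨𝐜 n k, corner_mem n k⟩
    · obtain ⟨k, rfl⟩ := hv
      have hsum : ∑ l, (Pi.single i t - Pi.single j t : Fin 3 → ℝ) l = 0 := by simp
      rw [hh.current_corner, hsum]
      simp only [Pi.sub_apply, Pi.single_apply, Subtype.mk.injEq, (corner_injective n).eq_iff]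
      have h3 : ((3 : ℝ) / 5) ^ n * (3 * t) = 1 := by rw [ht, mul_div_cancel₀ _ (by norm_num), hpow]
      split_ifs <;> linarith
    · push Not at hv
      rw [hh.current_interior _ ⟨v.2, fun k e => hv k (Subtype.ext e)⟩]
      simp [hv i, hv j]

/-- The three corners of stage `n`, as a set of vertices of the graph. -/
def sierpinskiCorners (n : ℕ) : Finset (sierpinskiVertices n) :=
  univ.image fun i => ⟨𝐜 n i, corner_mem n i⟩

/-- The corners of stage `n + 1` together with the junctions opposite to the corners in `T`. -/
def sierpinskiRoots (n : ℕ) (T : Finset (Fin 3)) : Finset (sierpinskiVertices (n + 1)) :=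
  sierpinskiCorners (n + 1) ∪ T.image fun k => ⟨sierpinskiJunction n k, sierpinskiJunction_mem n k⟩

theorem mem_sierpinskiCorners {v : sierpinskiVertices n} :
    v ∈ sierpinskiCorners n ↔ ∃ i, v.1 = 𝐜 n i := by
  simp [sierpinskiCorners, Subtype.ext_iff, eq_comm]

theorem mem_sierpinskiRoots {T : Finset (Fin 3)} {v : sierpinskiVertices (n + 1)} :
    v ∈ sierpinskiRoots n T ↔
      (∃ i, v.1 = 𝐜 (n + 1) i) ∨ ∃ k ∈ T, v.1 = sierpinskiJunction n k := by
  simp [sierpinskiRoots, mem_sierpinskiCorners, Subtype.ext_iff, eq_comm]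

theorem notMem_sierpinskiCorners {v : sierpinskiVertices n} :
    v ∉ sierpinskiCorners n ↔ IsSierpinskiInterior n v.1 := by
  simp [mem_sierpinskiCorners, IsSierpinskiInterior]

theorem notMem_sierpinskiRoots_univ {v : sierpinskiVertices (n + 1)} :
    v ∉ sierpinskiRoots n univ ↔ ∃ i y, IsSierpinskiInterior n y ∧ v.1 = y + 𝐜 n i := by
  rw [mem_sierpinskiRoots]
  constructor
  · intro h
    rcases sierpinskiVertices_succ_cases v.2 with hv | ⟨i, j, hij, hv⟩ | hv
    · exact absurd (Or.inl hv) h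
    · obtain ⟨k, hk⟩ := exists_eq_sierpinskiJunction n hij
      exact absurd (Or.inr ⟨k, mem_univ k, hv.trans hk⟩) h
    · exact hv
  · rintro ⟨i, y, hy, hv⟩ (⟨j, hj⟩ | ⟨k, -, hk⟩)
    · exact hy.add_corner_ne i j j (by rw [← hv, hj, corner_add_self])
    · exact hy.add_corner_ne i _ _ (hv.symm.trans hk)

/-- The determinant whose value is the number of spanning forests of stage `n` with three
components, each containing one corner. -/
noncomputable def sierpinskiDet (n : ℕ) : ℝ :=
  ((sierpinskiTriangle n).dirichletMatrix (sierpinskiCorners n)).det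

theorem det_dirichletMatrix_two_corners (hij : i ≠ j) :
    ((sierpinskiTriangle n).dirichletMatrix
      {⟨𝐜 n i, corner_mem n i⟩, ⟨𝐜 n j, corner_mem n j⟩}).det =
        2 * (3 / 5) ^ n * sierpinskiDet n := by
  obtain ⟨k, hki, hkj, hk⟩ : ∃ k, k ≠ i ∧ k ≠ j ∧ ∀ l, l = i ∨ l = j ∨ l = k := by
    revert i j; decide
  obtain ⟨h, hh⟩ := exists_isSierpinskiHarmonic n (Pi.single k 1)
  have hins : insert ⟨𝐜 n k, corner_mem n k⟩
      ({⟨𝐜 n i, corner_mem n i⟩, ⟨𝐜 n j, corner_mem n j⟩} : Finset (sierpinskiVertices n)) =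
      sierpinskiCorners n := by
    ext v
    simp only [mem_insert, mem_singleton, mem_sierpinskiCorners, Subtype.ext_iff]
    constructor
    · rintro (h | h | h) <;> exact ⟨_, h⟩
    · rintro ⟨l, hl⟩
      rcases hk l with rfl | rfl | rfl <;> tauto
  rw [sierpinskiDet, ← hins]
  refine det_dirichletMatrix_eq_mul_insert (h := fun w => h w.1) ?_ ?_ ?_ ?_
  · simp [(corner_injective n).eq_iff, hki, hkj]
  · intro r hr
    simp only [mem_insert, mem_singleton] at hr
    rcases hr with rfl | rfl <;> simp [hh.corner, hki.symm, hkj.symm]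
  · simp [hh.corner]
  · intro u hu
    rw [sierpinskiTriangle_lapMatrix_mulVec]
    split_ifs with huk
    · subst huk
      rw [hh.current_corner]
      simp
      ring
    · refine hh.current_interior _ (notMem_sierpinskiCorners.1 ?_)
      rw [← hins, mem_insert, not_or]
      exact ⟨huk, hu⟩

/-- Adding the junction `k` to the roots, by eliminating it from the `3 × 3` matrix `5 I - J` of the
junctions; `t` is the potential at the junctions. -/
theorem det_dirichletMatrix_sierpinskiRoots_insert {T : Finset (Fin 3)} {k : Fin 3} (hk : k ∉ T)
    (t : Fin 3 → ℝ) {α : ℝ} (hT : ∀ l ∈ T, t l = 0) (htk : t k = 1)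
    (ht : ∀ l ∉ T, 5 * t l - ∑ m, t m = if l = k then α else 0) :
    ((sierpinskiTriangle (n + 1)).dirichletMatrix (sierpinskiRoots n T)).det =
      (3 / 5) ^ n * α *
        ((sierpinskiTriangle (n + 1)).dirichletMatrix (sierpinskiRoots n (insert k T))).det := by
  obtain ⟨H, h1, h2, h3, h4⟩ := exists_junction_potential n t
  have hins : sierpinskiRoots n (insert k T) =
      insert ⟨sierpinskiJunction n k, sierpinskiJunction_mem n k⟩ (sierpinskiRoots n T) := by
    rw [sierpinskiRoots, image_insert, union_insert, sierpinskiRoots]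
  rw [hins]
  refine det_dirichletMatrix_eq_mul_insert (h := fun w => H w.1) ?_ ?_ ?_ ?_
  · rw [mem_sierpinskiRoots]
    rintro (⟨i, hi⟩ | ⟨l, hl, h⟩)
    · exact sierpinskiJunction_ne_corner n k i hi
    · exact hk (sierpinskiJunction_injective n h ▸ hl)
  · intro r hr
    rcases mem_sierpinskiRoots.1 hr with ⟨i, hi⟩ | ⟨l, hl, h⟩
    · simp only [hi, h1]
    · simp only [h, h2, hT l hl]
  · simp only [h2, htk]
  · intro u hu
    rw [sierpinskiTriangle_lapMatrix_mulVec]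
    by_cases hu' : u ∈ sierpinskiRoots n univ
    · rcases mem_sierpinskiRoots.1 hu' with hi | ⟨l, -, hl⟩
      · exact absurd (mem_sierpinskiRoots.2 (Or.inl hi)) hu
      · have hlT : l ∉ T := fun h => hu (mem_sierpinskiRoots.2 (Or.inr ⟨l, h, hl⟩))
        rw [hl, h3, ht l hlT, mul_ite, mul_zero]
        refine if_congr ?_ rfl rfl
        rw [Subtype.ext_iff, hl, (sierpinskiJunction_injective n).eq_iff]
    · obtain ⟨i, y, hy, hu''⟩ := notMem_sierpinskiRoots_univ.1 hu'
      rw [hu'', h4 i y hy, if_neg]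
      rintro rfl
      exact hu' (mem_sierpinskiRoots.2 (Or.inr ⟨k, mem_univ k, rfl⟩))

theorem sierpinskiTriangle_lapMatrix_apply (v w : sierpinskiVertices n) [Decidable
    ((sierpinskiLattice n).Adj v.1 w.1)] :
    (sierpinskiTriangle n).lapMatrix ℝ v w =
      (if v.1 = w.1 then ((sierpinskiNeighbors n v.1).card : ℝ) else 0) -
        if (sierpinskiLattice n).Adj v.1 w.1 then 1 else 0 := by
  rw [lapMatrix, Matrix.sub_apply, degMatrix, diagonal_apply, adjMatrix_apply,
    sierpinskiTriangle_degree]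
  congr 1
  · exact if_congr Subtype.ext_iff rfl rfl
  · congr 1

theorem IsSierpinskiInterior.adj_add_corner (hx : IsSierpinskiInterior n x) :
    (sierpinskiLattice (n + 1)).Adj (x + 𝐜 n i) z ↔
      ∃ y, (sierpinskiLattice n).Adj x y ∧ y + 𝐜 n i = z := by
  rw [← mem_sierpinskiNeighbors, sierpinskiNeighbors_add_corner fun j _ => hx.2 j]
  simp [mem_sierpinskiNeighbors]

/-- Without the corners and junctions, stage `n + 1` falls into the interiors of three copies of
stage `n`. -/
theorem det_dirichletMatrix_sierpinskiRoots_univ :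
    ((sierpinskiTriangle (n + 1)).dirichletMatrix (sierpinskiRoots n univ)).det =
      sierpinskiDet n ^ 3 := by
  classical
  rw [det_dirichletMatrix_eq_det_lapMatrix]
  choose b c hc hb using fun v : {v // v ∉ sierpinskiRoots n univ} =>
    notMem_sierpinskiRoots_univ.1 v.2
  rw [BlockTriangular.det_fintype (b := b), Finset.prod_eq_pow_card (b := sierpinskiDet n)]
  · simp
  · intro i _
    rw [sierpinskiDet, det_dirichletMatrix_eq_det_lapMatrix]
    let e₀ : {v // v ∉ sierpinskiCorners n} → {v // v ∉ sierpinskiRoots n univ} := fun v =>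
      ⟨⟨v.1.1 + 𝐜 n i, add_corner_mem v.1.2 i⟩,
        notMem_sierpinskiRoots_univ.2 ⟨i, v.1.1, notMem_sierpinskiCorners.1 v.2, rfl⟩⟩
    have he₀ : ∀ v, b (e₀ v) = i := fun v =>
      ((notMem_sierpinskiCorners.1 v.2).eq_of_add_eq_add (hb (e₀ v))).symm
    let e : {v // v ∉ sierpinskiCorners n} ≃ {v // b v = i} :=
      Equiv.ofBijective (fun v => ⟨e₀ v, he₀ v⟩) ⟨fun v w h => by
        have : v.1.1 + 𝐜 n i = w.1.1 + 𝐜 n i :=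
          congrArg (fun u : {v // b v = i} => u.1.1.1) h
        exact Subtype.ext (Subtype.ext (add_right_cancel this)), fun v => by
        refine ⟨⟨⟨c v.1, (hc v.1).1⟩, notMem_sierpinskiCorners.2 (hc v.1)⟩, ?_⟩
        refine Subtype.ext (Subtype.ext (Subtype.ext ?_))
        exact (congrArg (fun k => c v.1 + 𝐜 n k) v.2.symm).trans (hb v.1).symm⟩
    rw [← det_submatrix_equiv_self e]
    congr 1
    ext v w
    have hv := notMem_sierpinskiCorners.1 v.2
    change (sierpinskiTriangle (n + 1)).lapMatrix ℝ (e₀ v).1 (e₀ w).1 =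
      (sierpinskiTriangle n).lapMatrix ℝ v.1 w.1
    rw [sierpinskiTriangle_lapMatrix_apply, sierpinskiTriangle_lapMatrix_apply]
    simp only [e₀, hv.adj_add_corner, add_left_inj, exists_eq_right,
      sierpinskiNeighbors_add_corner fun j _ => hv.2 j, card_map]
  · intro v w hvw
    have key : ∀ z, z + 𝐜 n (b v) ≠ w.1.1 := fun z h =>
      hvw.ne ((hc w).eq_of_add_eq_add ((hb w).symm.trans h.symm))
    rw [submatrix_apply, sierpinskiTriangle_lapMatrix_apply, if_neg, if_neg, sub_zero]
    · rw [hb v, (hc v).adj_add_corner]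
      rintro ⟨y, -, h⟩
      exact key y h
    · rw [hb v]
      exact key _

theorem sierpinskiDet_zero : sierpinskiDet 0 = 1 := by
  rw [sierpinskiDet, det_dirichletMatrix_eq_det_lapMatrix]
  have : IsEmpty {v // v ∉ sierpinskiCorners 0} := by
    refine ⟨fun v => ?_⟩
    have hv := notMem_sierpinskiCorners.1 v.2
    obtain ⟨i, hi⟩ := exists_eq_corner_of_mem_zero hv.1
    exact hv.2 i hi
  exact det_isEmpty

/-- Eliminating the junctions one at a time gives the pivots `10 / 3`, `15 / 4` and `4` of the
matrix `5 I - J`, whose product is `50`. -/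
theorem sierpinskiDet_succ (n : ℕ) :
    sierpinskiDet (n + 1) = 50 * (3 / 5) ^ (3 * n) * sierpinskiDet n ^ 3 := by
  have h0 : sierpinskiCorners (n + 1) = sierpinskiRoots n ∅ := by simp [sierpinskiRoots]
  have hu : insert 2 (insert 1 (insert 0 ∅)) = (univ : Finset (Fin 3)) := by decide
  rw [sierpinskiDet, h0,
    det_dirichletMatrix_sierpinskiRoots_insert (k := 0) (by decide) ![1, 1 / 3, 1 / 3]
      (α := 10 / 3),
    det_dirichletMatrix_sierpinskiRoots_insert (k := 1) (by decide) ![0, 1, 1 / 4]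
      (α := 15 / 4),
    det_dirichletMatrix_sierpinskiRoots_insert (k := 2) (by decide) ![0, 0, 1]
      (α := 4), hu, det_dirichletMatrix_sierpinskiRoots_univ]
  · ring
  all_goals first
    | rfl
    | (intro l hl; fin_cases l <;> simp [Fin.sum_univ_three] at hl ⊢ <;> norm_num)

theorem sierpinskiDet_eq (n : ℕ) :
    sierpinskiDet n = (2 : ℝ) ^ (((3 : ℝ) ^ n - 1) / 2) *
      (3 : ℝ) ^ (((3 : ℝ) ^ (n + 1) - 6 * (n : ℝ) - 3) / 4) *
      (5 : ℝ) ^ (((3 : ℝ) ^ n + 6 * (n : ℝ) - 1) / 4) := by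
  induction n with
  | zero => rw [sierpinskiDet_zero]; norm_num
  | succ n ih =>
    have h35 : ((3 : ℝ) / 5) ^ (3 * n) = (3 : ℝ) ^ (3 * n : ℝ) * (5 : ℝ) ^ (-(3 * n) : ℝ) := by
      rw [Real.rpow_neg (by norm_num), div_pow, div_eq_mul_inv]
      norm_cast
    have h50 : (50 : ℝ) = (2 : ℝ) ^ (1 : ℝ) * (5 : ℝ) ^ (2 : ℝ) := by norm_num
    rw [sierpinskiDet_succ, ih, h35, h50, mul_pow, mul_pow, ← Real.rpow_mul_natCast (by norm_num),
      ← Real.rpow_mul_natCast (by norm_num), ← Real.rpow_mul_natCast (by norm_num)]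
    have e2 : ((3 : ℝ) ^ (n + 1) - 1) / 2 = 1 + ((3 : ℝ) ^ n - 1) / 2 * (3 : ℕ) := by
      push_cast; ring
    have e3 : ((3 : ℝ) ^ (n + 1 + 1) - 6 * ((n + 1 : ℕ) : ℝ) - 3) / 4 =
        3 * n + ((3 : ℝ) ^ (n + 1) - 6 * (n : ℝ) - 3) / 4 * (3 : ℕ) := by
      push_cast; ring
    have e5 : ((3 : ℝ) ^ (n + 1) + 6 * ((n + 1 : ℕ) : ℝ) - 1) / 4 =
        2 + -(3 * n) + ((3 : ℝ) ^ n + 6 * (n : ℝ) - 1) / 4 * (3 : ℕ) := by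
      push_cast; ring
    rw [e2, e3, e5]
    simp only [Real.rpow_add (show (0 : ℝ) < 2 by norm_num),
      Real.rpow_add (show (0 : ℝ) < 3 by norm_num), Real.rpow_add (show (0 : ℝ) < 5 by norm_num)]
    ring

end Sierpinski

theorem mainTheorem8 (n : ℕ) (a b : sierpinskiVertices n) (hab : a ≠ b)
    (ha : (sierpinskiTriangle n).degree a = 2) (hb : (sierpinskiTriangle n).degree b = 2) :
    (sierpinskiTriangle n).resistanceDist a b = 2 / 3 * (5 / 3) ^ n ∧
    ((sierpinskiTriangle n).separatingTwoForestCount a b : ℝ) =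
      (2 : ℝ) ^ (((3 : ℝ) ^ n + 1) / 2) *
      (3 : ℝ) ^ (((3 : ℝ) ^ (n + 1) - 2 * (n : ℝ) - 3) / 4) *
      (5 : ℝ) ^ (((3 : ℝ) ^ n + 2 * (n : ℝ) - 1) / 4) := by
  obtain ⟨i, rfl⟩ := Sierpinski.exists_eq_corner_of_degree_eq_two a ha
  obtain ⟨j, rfl⟩ := Sierpinski.exists_eq_corner_of_degree_eq_two b hb
  have hij : i ≠ j := fun h => hab (by subst h; rfl)
  refine ⟨Sierpinski.sierpinskiTriangle_resistanceDist hij, ?_⟩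
  rw [SimpleGraph.separatingTwoForestCount_eq_det hab, Sierpinski.det_dirichletMatrix_two_corners hij,
    Sierpinski.sierpinskiDet_eq]
  have h35 : ((3 : ℝ) / 5) ^ n = (3 : ℝ) ^ (n : ℝ) * (5 : ℝ) ^ (-n : ℝ) := by
    rw [Real.rpow_neg (by norm_num), div_pow, div_eq_mul_inv]
    norm_cast
  have e2 : ((3 : ℝ) ^ n + 1) / 2 = 1 + ((3 : ℝ) ^ n - 1) / 2 := by ring
  have e3 : ((3 : ℝ) ^ (n + 1) - 2 * (n : ℝ) - 3) / 4 =
      n + ((3 : ℝ) ^ (n + 1) - 6 * (n : ℝ) - 3) / 4 := by ring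
  have e5 : ((3 : ℝ) ^ n + 2 * (n : ℝ) - 1) / 4 =
      -n + ((3 : ℝ) ^ n + 6 * (n : ℝ) - 1) / 4 := by ring
  rw [h35, e2, e3, e5, Real.rpow_add (by norm_num), Real.rpow_add (by norm_num),
    Real.rpow_add (by norm_num), Real.rpow_one]
  ring
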